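/- **Theorem 2.** Let $(X_t)_{t\ge 0}$ be a bilateral birth-and-death process on $\mathbb Z$ with birth rates $\lambda_n>0$ and death rates $\mu_n>0$ ($n\in\mathbb Z$). That is, $X$ is a time-homogeneous Markov process, whose paths are right-continuous step functions with left limits in $\mathbb Z$ up to a possible explosion time (after which $X$ stays in a cemetery state), such that as $\delta\downarrow 0$ a process started at $n$ is at time $\delta$ in $n+1$ with probability $\lambda_n\delta+o(\delta)$, in $n-1$ with probability $\mu_n\delta+o(\delta)$, and in $n$ with probability $1-(\lambda_n+\mu_n)\delta+o(\delta)$. Let $(\nu_n)_{n\in\mathbb Z}$ be a strictly monotonic sequence of positive numbers with $$\nu_{n+1}\lambda_n-\nu_n(\lambda_n+\mu_n)+\nu_{n-1}\mu_n=0\qquad(n\in\mathbb Z),$$ and let $\widetilde X_t$ be a bilateral birth-and-death process (in the same sense) with rates $$\widetilde\lambda_n=\lambda_n\frac{\nu_{n+1}}{\nu_n},\qquad \widetilde\mu_n=\mu_n\frac{\nu_{n-1}}{\nu_n}\qquad(n\in\mathbb Z).$$ For $k\ne s$ and $t>0$ let $$g_{k,s}(t)=\frac{d}{dt}\Pr\bigl(\inf\{u>0: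 X_u=s\}<t\,\big|\,X_0=k\bigr)$$ be the first-passage-time density of $X$ from $k$ to $s$, let $\mathcal P_{k,s}=\int_0^\infty g_{k,s}(t)\,dt$ be the ultimate crossing probability, and let $\widetilde g_{k,s}$, $\widetilde{\mathcal P}_{k,s}$ be the corresponding quantities for $\widetilde X$. Then, for all $k\neq s$, these (possibly defective) densities exist: both distribution functions are differentiable at every $t>0$ and are the integrals over $(0,t)$ of their derivatives, which are integrable on $(0,\infty)$. Moreover, $$\widetilde g_{k,s}(t)=\frac{\nu_s}{\nu_k}\,g_{k,s}(t)\quad(t>0),\qquad \widetilde{\mathcal P}_{k,s}=\frac{\nu_s}{\nu_k}\,\mathcal P_{k,s},\qquad \widetilde{\mathcal P}_{k,s}\neq\mathcal P_{k,s}.$$ -/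

import Mathlib

open MeasureTheory Filter Topology Set
open scoped NNReal ENNReal

/-- `X`, under the family of laws `P k` (`k` the initial state), is a bilateral birth-and-death
process with birth rates `lam n` and death rates `mu n`.

States are integers; the extra value `none` is a cemetery, which is entered only if the process
explodes (i.e. makes infinitely many jumps in finite time). Processes that never explode are those
that never take the value `none`; non-explosion is not required. Up to explosion the paths are
right-continuous step functions with left limits in `ℤ`, so that the rates determine the law. -/
structure IsBilateralBirthDeath (lam mu : ℤ → ℝ) {Ω : Type*} [MeasurableSpace Ω]
    (P : ℤ → Measure Ω) (X : ℝ≥0 → Ω → Option ℤ) : Prop where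
  birth_pos : ∀ n, 0 < lam n
  death_pos : ∀ n, 0 < mu n
  isProbabilityMeasure : ∀ k, IsProbabilityMeasure (P k)
  measurableSet_eq : ∀ t (n : ℤ), MeasurableSet {ω | X t ω = some n}
  initial : ∀ k, ∀ᵐ ω ∂P k, X 0 ω = some k
  /-- Paths are right-continuous (`ℤ` being discrete) at every time before explosion. -/
  right_continuous : ∀ k, ∀ᵐ ω ∂P k, ∀ t (n : ℤ), X t ω = some n →
    ∀ᶠ u in 𝓝[>] t, X u ω = some n
  /-- Paths have left limits in `ℤ` at every time before explosion. -/
  left_limit : ∀ k, ∀ᵐ ω ∂P k, ∀ t (n : ℤ), X t ω = some n →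
    ∃ m : ℤ, ∀ᶠ u in 𝓝[<] t, X u ω = some m
  /-- The cemetery is absorbing. -/
  absorbing : ∀ k, ∀ᵐ ω ∂P k, ∀ t u, t ≤ u → X t ω = none → X u ω = none
  /-- The (time-homogeneous) Markov property with respect to the past `σ(X r, r ≤ t)`. -/
  markov : ∀ (k : ℤ) (t u : ℝ≥0) (i j : ℤ) (A : Set Ω),
    MeasurableSet[⨆ r : Set.Iic t, (⊤ : MeasurableSpace (Option ℤ)).comap (X r)] A →
    P k (A ∩ {ω | X t ω = some i} ∩ {ω | X (t + u) ω = some j}) =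
      P k (A ∩ {ω | X t ω = some i}) * P i {ω | X u ω = some j}
  birth_rate : ∀ n : ℤ, Tendsto (fun δ : ℝ≥0 => (P n).real {ω | X δ ω = some (n + 1)} / (δ : ℝ))
    (𝓝[>] 0) (𝓝 (lam n))
  death_rate : ∀ n : ℤ, Tendsto (fun δ : ℝ≥0 => (P n).real {ω | X δ ω = some (n - 1)} / (δ : ℝ))
    (𝓝[>] 0) (𝓝 (mu n))
  /-- Together with the two limits above: all other transitions have probability `o(δ)`. -/
  leave_rate : ∀ n : ℤ, Tendsto (fun δ : ℝ≥0 => (1 - (P n).real {ω | X δ ω = some n}) / (δ : ℝ))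
    (𝓝[>] 0) (𝓝 (lam n + mu n))

noncomputable section

/-- The first-passage time `inf {t > 0 : X t = s}`, equal to `∞` if `s` is never visited. -/
def firstPassageTime {Ω : Type*} (X : ℝ≥0 → Ω → Option ℤ) (s : ℤ) (ω : Ω) : ℝ≥0∞ :=
  ⨅ (t : ℝ≥0) (_ : 0 < t ∧ X t ω = some s), (t : ℝ≥0∞)

/-- `t ↦ Pr (inf {u > 0 : X u = s} < t | X 0 = k)`. -/
def firstPassageCDF {Ω : Type*} [MeasurableSpace Ω] (P : ℤ → Measure Ω)
    (X : ℝ≥0 → Ω → Option ℤ) (k s : ℤ) (t : ℝ) : ℝ :=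
  (P k).real {ω | firstPassageTime X s ω < ENNReal.ofReal t}

/-- The first-passage-time density `g k s t`, the derivative of `firstPassageCDF`. -/
def firstPassageDensity {Ω : Type*} [MeasurableSpace Ω] (P : ℤ → Measure Ω)
    (X : ℝ≥0 → Ω → Option ℤ) (k s : ℤ) (t : ℝ) : ℝ :=
  deriv (firstPassageCDF P X k s) t

/-- The first-passage time from `k` to `s` has `firstPassageDensity` as a genuine
(possibly defective) density. -/
def HasFirstPassageDensity {Ω : Type*} [MeasurableSpace Ω] (P : ℤ → Measure Ω)
    (X : ℝ≥0 → Ω → Option ℤ) (k s : ℤ) : Prop :=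
  (∀ t : ℝ, 0 < t → DifferentiableAt ℝ (firstPassageCDF P X k s) t) ∧
  IntegrableOn (firstPassageDensity P X k s) (Ioi 0) ∧
  ∀ t : ℝ, 0 ≤ t → firstPassageCDF P X k s t = ∫ u in (0 : ℝ)..t, firstPassageDensity P X k s u

/-- The ultimate crossing probability, `∫₀^∞ g k s t dt`. -/
def crossingProbability {Ω : Type*} [MeasurableSpace Ω] (P : ℤ → Measure Ω)
    (X : ℝ≥0 → Ω → Option ℤ) (k s : ℤ) : ℝ :=
  ∫ t in Ioi (0 : ℝ), firstPassageDensity P X k s t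

end

/-! The theorem is a Doob transform seen through finite windows. For finite `K`, the probability of
reaching `s` before `t` without first leaving `K` is the `(k, s)` entry of `exp (t • Q)`, where `Q`
is the generator absorbed at `s` and killed outside `K` (`real_reachesWithin`). With `D = diag(nu)`,
harmonicity of `nu` says that the generator for the transformed rates is `D⁻¹ * Q * D`, so the
entries differ by the factor `nu s / nu k` (`absorptionProbability_doobTransform`). A path that
reaches `s` has visited only finitely many states by then, so as `K` grows to `ℤ` the factor passes
to the distribution functions, explosive or not (`tendsto_absorptionProbability`).

The matrix exponential comes from sampling on a grid of mesh `δ`: the Markov property makes the law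
of the absorbed skeleton a matrix power, the rates make its transition matrix `1 + δ • (Q + o(1))`,
and right-continuity makes sampling exact in the limit.

The backward equation, integrated and taken to the limit, gives smoothness of the distribution
function for `t > 0` and, by induction on the distance to `s`, its positivity. Crossing
probabilities are therefore positive, and injectivity of `nu` keeps them distinct. -/

/-! ### Powers of near-identity elements and the exponential -/

theorem norm_pow_sub_pow_le_of_norm_le {𝔸 : Type*} [NormedRing 𝔸] [NormOneClass 𝔸] {x y : 𝔸}
    {M : ℝ} (hM : 1 ≤ M) (hx : ‖x‖ ≤ M) (hy : ‖y‖ ≤ M) (n : ℕ) :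
    ‖x ^ n - y ^ n‖ ≤ n * M ^ n * ‖x - y‖ := by
  have hM0 : 0 ≤ M := zero_le_one.trans hM
  induction n with
  | zero => simp
  | succ n ih =>
    have hxn : ‖x ^ n‖ ≤ M ^ n := (norm_pow_le x n).trans (by gcongr)
    have hpow : M ^ n ≤ M ^ (n + 1) := pow_le_pow_right₀ hM n.le_succ
    calc ‖x ^ (n + 1) - y ^ (n + 1)‖
        = ‖x ^ n * (x - y) + (x ^ n - y ^ n) * y‖ := by
          rw [pow_succ, pow_succ]; congr 1; noncomm_ring
      _ ≤ ‖x ^ n‖ * ‖x - y‖ + ‖x ^ n - y ^ n‖ * ‖y‖ :=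
          (norm_add_le _ _).trans (add_le_add (norm_mul_le _ _) (norm_mul_le _ _))
      _ ≤ M ^ (n + 1) * ‖x - y‖ + n * M ^ n * ‖x - y‖ * M := by
          gcongr
          exact hxn.trans hpow
      _ = (n + 1 : ℕ) * M ^ (n + 1) * ‖x - y‖ := by push_cast; ring

/-- If `A N = 1 + δ N • (Q + o(1))` with `δ N = t / (N + 1)`, then `A N ^ N → exp (t • Q)`. -/
theorem tendsto_pow_exp_of_tendsto_slope {𝔸 : Type*} [NormedRing 𝔸] [NormOneClass 𝔸]
    [NormedAlgebra ℝ 𝔸] [CompleteSpace 𝔸] {A : ℕ → 𝔸} {Q : 𝔸} {t : ℝ} (ht : 0 < t)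
    (hA : Tendsto (fun N : ℕ => (t / (N + 1))⁻¹ • (A N - 1)) atTop (𝓝 Q)) :
    Tendsto (fun N => A N ^ N) atTop (𝓝 (NormedSpace.exp (t • Q))) := by
  let _ : NormedAlgebra ℚ 𝔸 := NormedAlgebra.restrictScalars ℚ ℝ 𝔸
  -- Dividing by `N + 1` avoids `N = 0` and keeps the grid points `i * δ N`, `i ≤ N`, strictly below
  -- `t`, matching the strict inequality in the distribution function.
  set δ : ℕ → ℝ := fun N => t / (N + 1) with hδ
  have hδpos : ∀ N, 0 < δ N := fun N => by positivity
  have hδ0 : Tendsto δ atTop (𝓝 0) :=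
    tendsto_const_nhds.div_atTop
      (tendsto_atTop_add_const_right _ _ tendsto_natCast_atTop_atTop)
  have hNδ : Tendsto (fun N : ℕ => (N : ℝ) * δ N) atTop (𝓝 t) := by
    have h : Tendsto (fun N : ℕ => t - δ N) atTop (𝓝 (t - 0)) := tendsto_const_nhds.sub hδ0
    rw [sub_zero] at h
    refine h.congr fun N => ?_
    simp only [hδ]
    field_simp
    ring
  -- Comparison sequence: it has the same first-order term as `A`, and its powers are known exactly.
  set C : ℕ → 𝔸 := fun N => NormedSpace.exp (δ N • Q) with hC
  have hCs : Tendsto (fun N : ℕ => (δ N)⁻¹ • (C N - 1)) atTop (𝓝 Q) := by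
    have h := (hasDerivAt_exp_smul_const (𝕂 := ℝ) Q 0).tendsto_slope
    simp only [zero_smul, NormedSpace.exp_zero, one_mul] at h
    have h2 : Tendsto δ atTop (𝓝[≠] 0) :=
      tendsto_nhdsWithin_iff.2 ⟨hδ0, Eventually.of_forall fun N => (hδpos N).ne'⟩
    refine (h.comp h2).congr fun N => ?_
    simp [slope, hC]
  have hCpow : Tendsto (fun N => C N ^ N) atTop (𝓝 (NormedSpace.exp (t • Q))) := by
    have h : Tendsto (fun N : ℕ => NormedSpace.exp (((N : ℝ) * δ N) • Q)) atTop
        (𝓝 (NormedSpace.exp (t • Q))) :=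
      (NormedSpace.exp_continuous.tendsto _).comp (hNδ.smul_const Q)
    refine h.congr fun N => ?_
    rw [hC, ← NormedSpace.exp_nsmul, mul_smul, Nat.cast_smul_eq_nsmul]
  set M := ‖Q‖ + 1 with hM
  have hMpos : 0 < M := by positivity
  have bound : ∀ D : ℕ → 𝔸, Tendsto (fun N : ℕ => (δ N)⁻¹ • (D N - 1)) atTop (𝓝 Q) →
      ∀ᶠ N in atTop, ‖D N‖ ≤ Real.exp (δ N * M) := by
    intro D hD
    filter_upwards [hD.norm.eventually (ge_mem_nhds (lt_add_one ‖Q‖))] with N hN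
    have : D N = 1 + δ N • ((δ N)⁻¹ • (D N - 1)) := by
      rw [smul_inv_smul₀ (hδpos N).ne']; abel
    rw [this]
    refine (norm_add_le _ _).trans ?_
    rw [norm_one, norm_smul, Real.norm_of_nonneg (hδpos N).le]
    have h1 := Real.add_one_le_exp (δ N * M)
    have h2 := mul_le_mul_of_nonneg_left hN (hδpos N).le
    linarith
  -- `A N - C N` is `δ N * o(1)`; the factor `N` from the power estimate is absorbed by `N * δ N ≤
  -- t`.
  have hdiff : Tendsto (fun N => A N ^ N - C N ^ N) atTop (𝓝 0) := by
    have hz : Tendsto (fun N => t * Real.exp (t * M) *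
        ‖(δ N)⁻¹ • (A N - 1) - (δ N)⁻¹ • (C N - 1)‖) atTop (𝓝 0) := by
      have := ((hA.sub hCs).norm).const_mul (t * Real.exp (t * M))
      rwa [sub_self, norm_zero, mul_zero] at this
    refine squeeze_zero_norm' ?_ hz
    filter_upwards [bound A hA, bound C hCs] with N h1 h2
    have hNt : (N : ℝ) * δ N ≤ t := by
      simp only [hδ]
      rw [mul_div_assoc', div_le_iff₀ (by positivity)]
      nlinarith
    have h3 := norm_pow_sub_pow_le_of_norm_le
      (Real.one_le_exp (mul_nonneg (hδpos N).le hMpos.le)) h1 h2 N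
    have h4 : ‖A N - C N‖ = δ N * ‖(δ N)⁻¹ • (A N - 1) - (δ N)⁻¹ • (C N - 1)‖ := by
      rw [← smul_sub, norm_smul, norm_inv, Real.norm_of_nonneg (hδpos N).le,
        mul_inv_cancel_left₀ (hδpos N).ne']
      congr 1; abel
    rw [← Real.exp_nat_mul, ← mul_assoc (N : ℝ) (δ N) M, h4] at h3
    refine h3.trans ?_
    set r := ‖(δ N)⁻¹ • (A N - 1) - (δ N)⁻¹ • (C N - 1)‖
    calc N * Real.exp (N * δ N * M) * (δ N * r) = (N * δ N) * Real.exp (N * δ N * M) * r := by ring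
      _ ≤ t * Real.exp (t * M) * r := by gcongr
  simpa using hdiff.add hCpow

/-! ### Absorption probabilities in a finite window -/

section Generator

open scoped Matrix.Norms.Operator

/-- The generator of the birth-and-death chain with rates `lam`, `mu`, absorbed at `s` and killed
on leaving the finite set `K`. -/
noncomputable def killedGenerator (lam mu : ℤ → ℝ) (s : ℤ) (K : Finset ℤ) : Matrix K K ℝ :=
  Matrix.of fun i j => if (i : ℤ) = s then 0 else
    lam i * (if (i : ℤ) + 1 = j then 1 else 0) + mu i * (if (i : ℤ) - 1 = j then 1 else 0) -
      (lam i + mu i) * (if (i : ℤ) = j then 1 else 0)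

/-- The probability that the killed and absorbed chain started at `k` has been absorbed at `s` by
time `t`, as an entry of the matrix exponential of its generator. -/
noncomputable def absorptionProbability (lam mu : ℤ → ℝ) (s : ℤ) (K : Finset ℤ) (k : ℤ) (t : ℝ) :
    ℝ :=
  if h : k ∈ K ∧ s ∈ K then NormedSpace.exp (t • killedGenerator lam mu s K) ⟨k, h.1⟩ ⟨s, h.2⟩
  else 0

variable {lam mu nu : ℤ → ℝ} {s k : ℤ} {K : Finset ℤ}

theorem absorptionProbability_of_mem (hk : k ∈ K) (hs : s ∈ K) (t : ℝ) :
    absorptionProbability lam mu s K k t =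
      NormedSpace.exp (t • killedGenerator lam mu s K) ⟨k, hk⟩ ⟨s, hs⟩ :=
  dif_pos ⟨hk, hs⟩

theorem absorptionProbability_of_notMem (hk : k ∉ K) (t : ℝ) :
    absorptionProbability lam mu s K k t = 0 :=
  dif_neg fun h => hk h.1

/-- Writing the derivative of the exponential with the generator on the left makes it act on the
starting state, hence a backward equation. -/
theorem hasDerivAt_absorptionProbability_sum (hk : k ∈ K) (hs : s ∈ K) (t : ℝ) :
    HasDerivAt (absorptionProbability lam mu s K k)
      (∑ j : K, killedGenerator lam mu s K ⟨k, hk⟩ j * absorptionProbability lam mu s K j t) t := by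
  have h := hasDerivAt_exp_smul_const' (𝕂 := ℝ) (killedGenerator lam mu s K) t
  have h2 := hasDerivAt_pi.1 (hasDerivAt_pi.1 h ⟨k, hk⟩) ⟨s, hs⟩
  have e : absorptionProbability lam mu s K k = fun u : ℝ =>
      NormedSpace.exp (u • killedGenerator lam mu s K) ⟨k, hk⟩ ⟨s, hs⟩ :=
    funext fun u => absorptionProbability_of_mem hk hs u
  rw [e]
  refine h2.congr_deriv ?_
  rw [Matrix.mul_apply]
  exact Finset.sum_congr rfl fun j _ => by
    rw [absorptionProbability_of_mem j.2 hs]; rfl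

/-- The backward equation. -/
theorem hasDerivAt_absorptionProbability (hks : k ≠ s) (hk : k ∈ K) (hs : s ∈ K) (t : ℝ) :
    HasDerivAt (absorptionProbability lam mu s K k)
      (lam k * absorptionProbability lam mu s K (k + 1) t +
        mu k * absorptionProbability lam mu s K (k - 1) t -
        (lam k + mu k) * absorptionProbability lam mu s K k t) t := by
  convert hasDerivAt_absorptionProbability_sum hk hs t using 1
  -- The default value `0` outside `K` encodes killing, so the neighbours of `k` need not lie in
  -- `K`.
  have hsum : ∀ m : ℤ, (∑ j ∈ K, (if m = j then (1 : ℝ) else 0) *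
      absorptionProbability lam mu s K j t) = absorptionProbability lam mu s K m t := by
    intro m
    simp only [ite_mul, one_mul, zero_mul, Finset.sum_ite_eq]
    split_ifs with hm
    · rfl
    · exact (absorptionProbability_of_notMem hm t).symm
  rw [← hsum (k + 1), ← hsum (k - 1), ← hsum k, Finset.mul_sum, Finset.mul_sum, Finset.mul_sum,
    ← Finset.sum_add_distrib, ← Finset.sum_sub_distrib, ← Finset.sum_coe_sort]
  refine Finset.sum_congr rfl fun j _ => ?_
  simp only [killedGenerator, Matrix.of_apply, if_neg hks]
  ring

theorem continuous_absorptionProbability : Continuous (absorptionProbability lam mu s K k) := by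
  by_cases h : k ∈ K ∧ s ∈ K
  · exact continuous_iff_continuousAt.2 fun t =>
      (hasDerivAt_absorptionProbability_sum h.1 h.2 t).continuousAt
  · have : absorptionProbability lam mu s K k = fun _ => 0 := funext fun t => dif_neg h
    rw [this]
    exact continuous_const

theorem absorptionProbability_zero (hks : k ≠ s) : absorptionProbability lam mu s K k 0 = 0 := by
  by_cases h : k ∈ K ∧ s ∈ K
  · rw [absorptionProbability_of_mem h.1 h.2, zero_smul, NormedSpace.exp_zero]
    exact Matrix.one_apply_ne fun e => hks (congrArg Subtype.val e)
  · exact dif_neg h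

theorem absorptionProbability_self (hs : s ∈ K) (t : ℝ) :
    absorptionProbability lam mu s K s t = 1 := by
  have hd : ∀ u, HasDerivAt (absorptionProbability lam mu s K s) 0 u := by
    intro u
    convert hasDerivAt_absorptionProbability_sum hs hs u using 1
    simp [killedGenerator]
  rw [is_const_of_deriv_eq_zero (fun u => (hd u).differentiableAt) (fun u => (hd u).deriv) t 0,
    absorptionProbability_of_mem hs hs, zero_smul, NormedSpace.exp_zero, Matrix.one_apply_eq]

/-- The integrated backward equation. -/
theorem exp_mul_absorptionProbability (hks : k ≠ s) (hk : k ∈ K) (hs : s ∈ K) (t : ℝ) :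
    Real.exp ((lam k + mu k) * t) * absorptionProbability lam mu s K k t =
      ∫ v in (0 : ℝ)..t, Real.exp ((lam k + mu k) * v) *
        (lam k * absorptionProbability lam mu s K (k + 1) v +
          mu k * absorptionProbability lam mu s K (k - 1) v) := by
  -- The integrating factor cancels the negative diagonal term.
  have hd : ∀ v, HasDerivAt
      (fun v => Real.exp ((lam k + mu k) * v) * absorptionProbability lam mu s K k v)
      (Real.exp ((lam k + mu k) * v) *
        (lam k * absorptionProbability lam mu s K (k + 1) v +
          mu k * absorptionProbability lam mu s K (k - 1) v)) v := by
    intro v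
    have h1 : HasDerivAt (fun v => Real.exp ((lam k + mu k) * v))
        (Real.exp ((lam k + mu k) * v) * ((lam k + mu k) * 1)) v :=
      ((hasDerivAt_id v).const_mul _).exp
    refine (h1.mul (hasDerivAt_absorptionProbability hks hk hs v)).congr_deriv ?_
    ring
  have hc : ∀ j, Continuous (absorptionProbability lam mu s K j) :=
    fun j => continuous_absorptionProbability
  rw [intervalIntegral.integral_eq_sub_of_hasDerivAt (fun v _ => hd v)
    (Continuous.intervalIntegrable (by have := hc (k + 1); have := hc (k - 1); fun_prop) _ _),
    absorptionProbability_zero hks]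
  simp

/-- Absorption probabilities under the Doob transform by a harmonic function `nu`. -/
theorem absorptionProbability_doobTransform (hnu_pos : ∀ n, 0 < nu n)
    (hnu : ∀ n, nu (n + 1) * lam n - nu n * (lam n + mu n) + nu (n - 1) * mu n = 0) (t : ℝ) :
    absorptionProbability (fun n => lam n * (nu (n + 1) / nu n))
      (fun n => mu n * (nu (n - 1) / nu n)) s K k t =
        nu s / nu k * absorptionProbability lam mu s K k t := by
  by_cases h : k ∈ K ∧ s ∈ K
  swap
  · simp [absorptionProbability, h]
  set D : Matrix K K ℝ := Matrix.diagonal fun j => nu j with hD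
  set D' : Matrix K K ℝ := Matrix.diagonal fun j => (nu j)⁻¹ with hD'
  have hDD' : D * D' = 1 := by
    rw [hD, hD', Matrix.diagonal_mul_diagonal, ← Matrix.diagonal_one]
    exact congrArg _ (funext fun j => mul_inv_cancel₀ (hnu_pos j).ne')
  have hinv : D⁻¹ = D' := Matrix.inv_eq_right_inv hDD'
  have hunit : IsUnit D := IsUnit.of_mul_eq_one D' hDD'
  -- Off the diagonal this is the definition of the new rates; on it, harmonicity says that the
  -- total jump rate is unchanged. Row `s` is zero on both sides.
  have hconj : t • killedGenerator (fun n => lam n * (nu (n + 1) / nu n))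
      (fun n => mu n * (nu (n - 1) / nu n)) s K = D⁻¹ * (t • killedGenerator lam mu s K) * D := by
    rw [hinv]
    ext i j
    rw [hD, hD', Matrix.mul_diagonal, Matrix.diagonal_mul]
    simp only [killedGenerator, Matrix.smul_apply, Matrix.of_apply, smul_eq_mul]
    have hi := (hnu_pos i).ne'
    have h0 := hnu i
    by_cases h1 : (i : ℤ) = s
    · simp [h1]
    by_cases h2 : (i : ℤ) + 1 = j
    · simp [h1, ← h2]
      grind
    by_cases h3 : (i : ℤ) - 1 = j
    · simp [h1, ← h3]
      grind
    by_cases h4 : (i : ℤ) = j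
    · simp [h1, ← h4]
      field_simp
      linear_combination (-t) * h0
    · simp [h2, h3, h4]
  rw [absorptionProbability_of_mem h.1 h.2, absorptionProbability_of_mem h.1 h.2, hconj,
    Matrix.exp_conj' D _ hunit, hinv, hD, hD', Matrix.mul_diagonal, Matrix.diagonal_mul]
  ring

end Generator

/-! ### The absorbed skeleton on a time grid -/

section Skeleton

variable {Ω : Type*}

/-- One step of the chain absorbed at `s` and killed on leaving `K`: from the current state to the
next position `x` of the underlying process. -/
def absorbedStep (s : ℤ) (K : Finset ℤ) (x : Option ℤ) : Option ℤ → Option ℤ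
  | none => none
  | some i => if i = s then some s else if i ∈ K then x else none

/-- The process `X` observed at the multiples of `δ`, absorbed at `s` and killed on leaving `K`. -/
def absorbedSkeleton (X : ℝ≥0 → Ω → Option ℤ) (s : ℤ) (K : Finset ℤ) (δ : ℝ≥0) :
    ℕ → Ω → Option ℤ
  | 0, ω => X 0 ω
  | N + 1, ω => absorbedStep s K (X ((N + 1 : ℕ) * δ) ω) (absorbedSkeleton X s K δ N ω)

variable {X : ℝ≥0 → Ω → Option ℤ} {s : ℤ} {K : Finset ℤ} {δ : ℝ≥0}

theorem absorbedSkeleton_succ (N : ℕ) (ω : Ω) :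
    absorbedSkeleton X s K δ (N + 1) ω =
      absorbedStep s K (X ((N + 1 : ℕ) * δ) ω) (absorbedSkeleton X s K δ N ω) :=
  rfl

theorem absorbedSkeleton_succ_of_eq_target {N : ℕ} {ω : Ω}
    (h : absorbedSkeleton X s K δ N ω = some s) :
    absorbedSkeleton X s K δ (N + 1) ω = some s := by
  simp [absorbedSkeleton_succ, h, absorbedStep]

theorem absorbedSkeleton_succ_of_mem {N : ℕ} {ω : Ω} {i : ℤ} (his : i ≠ s) (hi : i ∈ K)
    (h : absorbedSkeleton X s K δ N ω = some i) :
    absorbedSkeleton X s K δ (N + 1) ω = X ((N + 1 : ℕ) * δ) ω := by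
  simp [absorbedSkeleton_succ, h, absorbedStep, his, hi]

theorem exists_of_absorbedSkeleton_succ (hs : s ∈ K) {N : ℕ} {ω : Ω} {j : ℤ}
    (h : absorbedSkeleton X s K δ (N + 1) ω = some j) :
    ∃ i ∈ K, absorbedSkeleton X s K δ N ω = some i := by
  rw [absorbedSkeleton_succ] at h
  rcases hY : absorbedSkeleton X s K δ N ω with _ | i
  · simp [hY, absorbedStep] at h
  · refine ⟨i, ?_, rfl⟩
    by_cases his : i = s
    · exact his ▸ hs
    · by_contra hi
      simp [hY, absorbedStep, his, hi] at h

/-- Until absorption or killing the skeleton is the sampled process. The last state `i` may lie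
outside `K`, since killing takes effect one step after the exit. -/
theorem eq_of_absorbedSkeleton_eq (hs : s ∈ K) {ω : Ω} : ∀ {N : ℕ} {i : ℤ}, i ≠ s →
    absorbedSkeleton X s K δ N ω = some i →
      X (N * δ) ω = some i ∧ ∀ l < N, ∃ n ∈ K, X (l * δ) ω = some n
  | 0, i, _, h => by simpa using (show X 0 ω = some i from h)
  | N + 1, i, his, h => by
    obtain ⟨j, hj, hY⟩ := exists_of_absorbedSkeleton_succ hs h
    by_cases hjs : j = s
    · subst hjs
      rw [absorbedSkeleton_succ_of_eq_target hY] at h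
      exact absurd (Option.some_injective _ h).symm his
    · obtain ⟨h1, h2⟩ := eq_of_absorbedSkeleton_eq hs hjs hY
      rw [absorbedSkeleton_succ_of_mem hjs hj hY] at h
      refine ⟨h, fun l hl => ?_⟩
      rcases (Nat.lt_succ_iff.1 hl).lt_or_eq with hl | rfl
      · exact h2 l hl
      · exact ⟨j, hj, h1⟩

/-- The skeleton is absorbed by step `N` iff it visits `s` by then without first leaving `K`. -/
theorem absorbedSkeleton_eq_target_iff (hs : s ∈ K) {N : ℕ} {ω : Ω} :
    absorbedSkeleton X s K δ N ω = some s ↔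
      ∃ i ≤ N, X (i * δ) ω = some s ∧ ∀ l < i, ∃ n ∈ K, X (l * δ) ω = some n := by
  constructor
  · induction N with
    | zero =>
      intro h
      exact ⟨0, le_rfl, by simpa using (show X 0 ω = some s from h), by simp⟩
    | succ N ih =>
      intro h
      obtain ⟨j, hj, hY⟩ := exists_of_absorbedSkeleton_succ hs h
      by_cases hjs : j = s
      · subst hjs
        obtain ⟨i, hi, h'⟩ := ih hY
        exact ⟨i, hi.trans N.le_succ, h'⟩
      · obtain ⟨h1, h2⟩ := eq_of_absorbedSkeleton_eq hs hjs hY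
        rw [absorbedSkeleton_succ_of_mem hjs hj hY] at h
        refine ⟨N + 1, le_rfl, h, fun l hl => ?_⟩
        rcases (Nat.lt_succ_iff.1 hl).lt_or_eq with hl | rfl
        · exact h2 l hl
        · exact ⟨j, hj, h1⟩
  · rintro ⟨i, hi, hXi, hl⟩
    have key : ∀ l ≤ i, absorbedSkeleton X s K δ l ω = some s ∨
        absorbedSkeleton X s K δ l ω = X (l * δ) ω := by
      intro l
      induction l with
      | zero => intro _; right; simp [absorbedSkeleton]
      | succ l ih =>
        intro hli
        rcases ih (Nat.le_of_succ_le hli) with h | h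
        · exact Or.inl (absorbedSkeleton_succ_of_eq_target h)
        · obtain ⟨n, hn, hXn⟩ := hl l hli
          rw [hXn] at h
          by_cases hns : n = s
          · subst hns
            exact Or.inl (absorbedSkeleton_succ_of_eq_target h)
          · exact Or.inr (absorbedSkeleton_succ_of_mem hns hn h)
    have hYi : absorbedSkeleton X s K δ i ω = some s := by
      rcases key i le_rfl with h | h
      · exact h
      · rw [h, hXi]
    induction N, hi using Nat.le_induction with
    | base => exact hYi
    | succ N _ ih => exact absorbedSkeleton_succ_of_eq_target ih

theorem setOf_absorbedSkeleton_succ_eq (hs : s ∈ K) (N : ℕ) (j : ℤ) :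
    {ω | absorbedSkeleton X s K δ (N + 1) ω = some j} =
      ⋃ i ∈ K, {ω | absorbedSkeleton X s K δ N ω = some i} ∩
        {ω | absorbedSkeleton X s K δ (N + 1) ω = some j} := by
  ext ω
  simp only [mem_ofPred_eq, mem_iUnion, mem_inter_iff, exists_prop]
  constructor
  · intro h
    obtain ⟨i, hi, hY⟩ := exists_of_absorbedSkeleton_succ hs h
    exact ⟨i, hi, hY, h⟩
  · rintro ⟨_, _, _, h⟩
    exact h

theorem setOf_absorbedSkeleton_inter_of_mem (N : ℕ) {i : ℤ} (his : i ≠ s) (hi : i ∈ K) (j : ℤ) :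
    {ω | absorbedSkeleton X s K δ N ω = some i} ∩
        {ω | absorbedSkeleton X s K δ (N + 1) ω = some j} =
      {ω | absorbedSkeleton X s K δ N ω = some i} ∩ {ω | X ((N + 1 : ℕ) * δ) ω = some j} := by
  ext ω
  simp only [mem_inter_iff, mem_ofPred_eq]
  refine and_congr_right fun h => ?_
  rw [absorbedSkeleton_succ_of_mem his hi h]

theorem setOf_absorbedSkeleton_inter_target (N : ℕ) (j : ℤ) :
    {ω | absorbedSkeleton X s K δ N ω = some s} ∩
        {ω | absorbedSkeleton X s K δ (N + 1) ω = some j} =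
      if j = s then {ω | absorbedSkeleton X s K δ N ω = some s} else ∅ := by
  ext ω
  split_ifs with h
  · subst h
    simpa using fun h => absorbedSkeleton_succ_of_eq_target h
  · simp only [mem_inter_iff, mem_ofPred_eq, mem_empty_iff_false, iff_false, not_and]
    intro hY hY'
    rw [absorbedSkeleton_succ_of_eq_target hY] at hY'
    exact h (Option.some_injective _ hY').symm

theorem measurableSet_past_eq {r t : ℝ≥0} (hr : r ≤ t) (n : ℤ) :
    MeasurableSet[⨆ r : Set.Iic t, (⊤ : MeasurableSpace (Option ℤ)).comap (X r)]
      {ω | X r ω = some n} := by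
  have hle : (⊤ : MeasurableSpace (Option ℤ)).comap (X r) ≤
      ⨆ r : Set.Iic t, (⊤ : MeasurableSpace (Option ℤ)).comap (X r) :=
    le_iSup (fun r : Set.Iic t => (⊤ : MeasurableSpace (Option ℤ)).comap (X r)) ⟨r, hr⟩
  exact hle _ ⟨{some n}, trivial, rfl⟩

/-- Makes skeleton events admissible as the past event `A` in the Markov property. -/
theorem measurableSet_past_absorbedSkeleton (hs : s ∈ K) {t : ℝ≥0} : ∀ (N : ℕ) (j : ℤ),
    N * δ ≤ t →
    MeasurableSet[⨆ r : Set.Iic t, (⊤ : MeasurableSpace (Option ℤ)).comap (X r)]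
      {ω | absorbedSkeleton X s K δ N ω = some j}
  | 0, j, h => measurableSet_past_eq zero_le j
  | N + 1, j, h => by
    have hN : N * δ ≤ t := le_trans (by gcongr; exact N.le_succ) h
    rw [setOf_absorbedSkeleton_succ_eq hs]
    refine Finset.measurableSet_biUnion K fun i hi => ?_
    by_cases his : i = s
    · rw [his, setOf_absorbedSkeleton_inter_target]
      split_ifs
      · exact measurableSet_past_absorbedSkeleton hs N s hN
      · exact @MeasurableSet.empty _ (_)
    · rw [setOf_absorbedSkeleton_inter_of_mem N his hi]
      exact (measurableSet_past_absorbedSkeleton hs N i hN).inter (measurableSet_past_eq h j)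

variable [MeasurableSpace Ω] {P : ℤ → Measure Ω} {lam mu : ℤ → ℝ}

/-- The one-step transition matrix of the absorbed skeleton. -/
noncomputable def skeletonMatrix (P : ℤ → Measure Ω) (X : ℝ≥0 → Ω → Option ℤ) (s : ℤ)
    (K : Finset ℤ) (δ : ℝ≥0) : Matrix K K ℝ :=
  Matrix.of fun i j => if (i : ℤ) = s then (if (j : ℤ) = s then 1 else 0) else
    (P i).real {ω | X δ ω = some (j : ℤ)}

namespace IsBilateralBirthDeath

theorem past_le (hX : IsBilateralBirthDeath lam mu P X)
    (t : ℝ≥0) :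
    (⨆ r : Set.Iic t, (⊤ : MeasurableSpace (Option ℤ)).comap (X r)) ≤ ‹MeasurableSpace Ω› := by
  refine iSup_le fun r => ?_
  have hsome : ∀ n : ℤ, MeasurableSet (X r ⁻¹' {some n}) := fun n => hX.measurableSet_eq r n
  have : @Measurable Ω (Option ℤ) _ ⊤ (X r) := by
    let _ : MeasurableSpace (Option ℤ) := ⊤
    refine measurable_to_countable' fun x => ?_
    rcases x with _ | n
    · have : X r ⁻¹' {none} = (⋃ n : ℤ, X r ⁻¹' {some n})ᶜ := by
        ext ω
        rcases h : X r ω with _ | m <;> simp [h]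
      rw [this]
      exact (MeasurableSet.iUnion hsome).compl
    · exact hsome n
  exact this.comap_le

theorem measurableSet_absorbedSkeleton (hX : IsBilateralBirthDeath lam mu P X)
    (hs : s ∈ K) (N : ℕ) (j : ℤ) :
    MeasurableSet {ω | absorbedSkeleton X s K δ N ω = some j} :=
  hX.past_le _ _ (measurableSet_past_absorbedSkeleton hs N j le_rfl)

theorem real_initial (hX : IsBilateralBirthDeath lam mu P X)
    (k j : ℤ) : (P k).real {ω | X 0 ω = some j} = if k = j then 1 else 0 := by
  have := hX.isProbabilityMeasure k
  split_ifs with h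
  · subst h
    rw [measureReal_def, prob_compl_eq_zero_iff (hX.measurableSet_eq 0 k) |>.1 (hX.initial k)]
    simp
  · rw [measureReal_eq_zero_iff, measure_eq_zero_iff_ae_notMem]
    filter_upwards [hX.initial k] with ω hω h'
    exact h (Option.some_injective _ (hω.symm.trans h'))

/-- The law of the absorbed skeleton is given by the powers of its transition matrix. -/
theorem real_absorbedSkeleton (hX : IsBilateralBirthDeath lam mu P X)
    (hs : s ∈ K) (k : K) (N : ℕ) (j : K) :
    (P k).real {ω | absorbedSkeleton X s K δ N ω = some (j : ℤ)} =
      (skeletonMatrix P X s K δ ^ N) k j := by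
  have := hX.isProbabilityMeasure k
  induction N generalizing j with
  | zero =>
    rw [pow_zero, Matrix.one_apply]
    refine (hX.real_initial k j).trans ?_
    exact if_congr Subtype.ext_iff.symm rfl rfl
  | succ N ih =>
    rw [setOf_absorbedSkeleton_succ_eq hs, measureReal_biUnion_finset, pow_succ, Matrix.mul_apply,
      ← Finset.sum_coe_sort]
    · refine Finset.sum_congr rfl fun i _ => ?_
      rw [← ih i]
      by_cases his : (i : ℤ) = s
      · rw [his, setOf_absorbedSkeleton_inter_target]
        simp only [skeletonMatrix, Matrix.of_apply, his, if_true]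
        split_ifs <;> simp
      · rw [setOf_absorbedSkeleton_inter_of_mem N his i.2]
        -- Away from `s` the skeleton event determines the present state of `X`, so it has the form
        -- `A ∩ {X t = i}` required by the Markov property.
        have hsub : {ω | absorbedSkeleton X s K δ N ω = some (i : ℤ)} =
            {ω | absorbedSkeleton X s K δ N ω = some (i : ℤ)} ∩ {ω | X (N * δ) ω = some (i : ℤ)} :=
          (inter_eq_left.2 fun ω hω => (eq_of_absorbedSkeleton_eq hs his hω).1).symm
        have hm := hX.markov k (N * δ) δ i j _
          (measurableSet_past_absorbedSkeleton (X := X) (δ := δ) hs N i le_rfl)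
        rw [← hsub, show (N : ℝ≥0) * δ + δ = (N + 1 : ℕ) * δ by push_cast; ring] at hm
        simp only [skeletonMatrix, Matrix.of_apply, if_neg his, measureReal_def, hm,
          ENNReal.toReal_mul]
    · intro i _ i' _ hii'
      refine Set.disjoint_left.2 fun ω h h' => hii' ?_
      exact Option.some_injective _ (h.1.symm.trans h'.1)
    · exact fun i _ => (hX.measurableSet_absorbedSkeleton hs N i).inter
        (hX.measurableSet_absorbedSkeleton hs (N + 1) j)

/-- The probabilities of `k`, `k + 1`, `k - 1` and `j` sum to at most `1`, and the first three
already account for `1 - o(δ)`. -/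
theorem tendsto_offDiagonal_rate (hX : IsBilateralBirthDeath lam mu P X)
    {k j : ℤ} (h1 : k + 1 ≠ j) (h2 : k - 1 ≠ j) (h3 : k ≠ j) :
    Tendsto (fun δ : ℝ≥0 => (P k).real {ω | X δ ω = some j} / (δ : ℝ)) (𝓝[>] 0) (𝓝 0) := by
  have := hX.isProbabilityMeasure k
  have hlim := ((hX.leave_rate k).sub (hX.birth_rate k)).sub (hX.death_rate k)
  rw [show lam k + mu k - lam k - mu k = 0 by ring] at hlim
  refine squeeze_zero (fun δ => by positivity) (fun δ => ?_) hlim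
  rw [← sub_div, ← sub_div]
  gcongr
  have hdisj : ((({k, k + 1, k - 1, j} : Finset ℤ) : Set ℤ)).PairwiseDisjoint
      fun n => {ω | X δ ω = some n} := by
    intro i _ i' _ hii'
    exact Set.disjoint_left.2 fun ω h h' => hii' (Option.some_injective _ (h.symm.trans h'))
  have hsum := measureReal_biUnion_finset (μ := P k) hdisj
    (fun n _ => hX.measurableSet_eq δ n)
  have hle := measureReal_le_one (μ := P k)
    (s := ⋃ n ∈ ({k, k + 1, k - 1, j} : Finset ℤ), {ω | X δ ω = some n})
  rw [hsum, Finset.sum_insert (by simp; omega), Finset.sum_insert (by simp; omega),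
    Finset.sum_insert (by simpa using h2), Finset.sum_singleton] at hle
  linarith

theorem tendsto_skeletonMatrix (hX : IsBilateralBirthDeath lam mu P X) :
    Tendsto (fun δ : ℝ≥0 => (δ : ℝ)⁻¹ • (skeletonMatrix P X s K δ - 1)) (𝓝[>] 0)
      (𝓝 (killedGenerator lam mu s K)) := by
  refine tendsto_pi_nhds.2 fun i => tendsto_pi_nhds.2 fun j => ?_
  simp only [Matrix.smul_apply, Matrix.sub_apply, skeletonMatrix, killedGenerator, Matrix.of_apply,
    Matrix.one_apply, Subtype.ext_iff, smul_eq_mul]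
  by_cases his : (i : ℤ) = s
  · simp [his, eq_comm]
  simp only [if_neg his]
  by_cases h3 : (i : ℤ) = j
  · have h1 : (i : ℤ) + 1 ≠ i := by omega
    have h2 : (i : ℤ) - 1 ≠ i := by omega
    simp only [← h3, if_neg h1, if_neg h2, if_true, mul_zero, mul_one, zero_add, zero_sub]
    exact (hX.leave_rate i).neg.congr fun δ => by ring
  by_cases h1 : (i : ℤ) + 1 = j
  · have h2 : (i : ℤ) - 1 ≠ i + 1 := by omega
    have h3 : (i : ℤ) ≠ i + 1 := by omega
    simp only [← h1, if_neg h2, if_neg h3, if_true, mul_zero, mul_one, add_zero, sub_zero]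
    exact (hX.birth_rate i).congr fun δ => by ring
  by_cases h2 : (i : ℤ) - 1 = j
  · have h1 : (i : ℤ) + 1 ≠ i - 1 := by omega
    have h3 : (i : ℤ) ≠ i - 1 := by omega
    simp only [← h2, if_neg h1, if_neg h3, if_true, mul_zero, mul_one, zero_add, sub_zero]
    exact (hX.death_rate i).congr fun δ => by ring
  simp only [if_neg h1, if_neg h2, if_neg h3, mul_zero, add_zero, sub_zero]
  exact (hX.tendsto_offDiagonal_rate h1 h2 h3).congr fun δ => by ring

end IsBilateralBirthDeath

end Skeleton

/-! ### Detecting visits of step paths by sampling -/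

section Paths

variable {x : ℝ≥0 → Option ℤ} {s : ℤ} {K : Finset ℤ}

/-- The path `x` visits `s` before time `t` without leaving `K` first. -/
def ReachesWithin (x : ℝ≥0 → Option ℤ) (s : ℤ) (K : Finset ℤ) (t : ℝ≥0) : Prop :=
  ∃ u < t, x u = some s ∧ ∀ v < u, ∃ n ∈ K, x v = some n

theorem tendsto_div_natCast_add_one (t : ℝ≥0) :
    Tendsto (fun N : ℕ => t / ((N : ℝ≥0) + 1)) atTop (𝓝 0) := by
  rw [← NNReal.tendsto_coe]
  push_cast
  exact tendsto_const_nhds.div_atTop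
    (tendsto_atTop_add_const_right _ _ tendsto_natCast_atTop_atTop)

/-- The witness is the first grid point at or after `u`, which precedes `w` once the mesh is below
`w - u`; as `N + 1` steps make up `t ≥ w`, its index is at most `N`. -/
theorem eventually_exists_mul_mem_Ico {t u w : ℝ≥0} (ht : 0 < t) (huw : u < w) (hwt : w ≤ t) :
    ∀ᶠ N : ℕ in atTop, ∃ i ≤ N, u ≤ i * (t / (N + 1)) ∧ i * (t / (N + 1)) < w ∧
      ∀ l < i, l * (t / (N + 1)) < u := by
  have hδ : Tendsto (fun N : ℕ => u + t / ((N : ℝ≥0) + 1)) atTop (𝓝 (u + 0)) :=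
    tendsto_const_nhds.add (tendsto_div_natCast_add_one t)
  rw [add_zero] at hδ
  filter_upwards [hδ.eventually (gt_mem_nhds huw)] with N hN
  set δ : ℝ≥0 := t / (N + 1) with hδdef
  have hδpos : 0 < δ := by positivity
  have hNδ : ((N + 1 : ℕ) : ℝ≥0) * δ = t := by
    rw [hδdef]; push_cast; field_simp
  have hlt : (⌈u / δ⌉₊ : ℝ≥0) * δ < w := by
    refine lt_trans ?_ hN
    have := Nat.ceil_lt_add_one (zero_le (a := u / δ))
    calc (⌈u / δ⌉₊ : ℝ≥0) * δ < (u / δ + 1) * δ := by gcongr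
      _ = u + δ := by field_simp
  refine ⟨⌈u / δ⌉₊, ?_, ?_, hlt, fun l hl => ?_⟩
  · have h : (⌈u / δ⌉₊ : ℝ≥0) * δ < ((N + 1 : ℕ) : ℝ≥0) * δ := by
      rw [hNδ]; exact hlt.trans_le hwt
    exact Nat.lt_succ_iff.1 (Nat.cast_lt.1 (lt_of_mul_lt_mul_right h hδpos.le))
  · rw [← div_le_iff₀ hδpos]
    exact Nat.le_ceil _
  · rw [← lt_div_iff₀ hδpos]
    exact Nat.lt_ceil.1 hl

/-- Visits to `s` within `K` are detected by sampling the path on fine enough grids. -/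
theorem eventually_grid_iff_reachesWithin
    (hright : ∀ t (n : ℤ), x t = some n → ∀ᶠ u in 𝓝[>] t, x u = some n)
    (habs : ∀ t u, t ≤ u → x t = none → x u = none) (hs : s ∈ K) {t : ℝ≥0} (ht : 0 < t) :
    ∀ᶠ N : ℕ in atTop, (∃ i ≤ N, x (i * (t / (N + 1))) = some s ∧
      ∀ l < i, ∃ n ∈ K, x (l * (t / (N + 1))) = some n) ↔ ReachesWithin x s K t := by
  have hstay : ∀ u (n : ℤ), x u = some n → ∃ w > u, ∀ v, u ≤ v → v < w → x v = some n := by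
    intro u n hu
    obtain ⟨w, hw, hsub⟩ := mem_nhdsGT_iff_exists_Ioo_subset.1 (hright u n hu)
    refine ⟨w, hw, fun v huv hvw => ?_⟩
    rcases huv.eq_or_lt with rfl | huv
    · exact hu
    · exact hsub ⟨huv, hvw⟩
  by_cases hreach : ReachesWithin x s K t
  · simp only [hreach, iff_true]
    obtain ⟨u, hut, hu, hK⟩ := hreach
    obtain ⟨w, huw, hw⟩ := hstay u s hu
    filter_upwards [eventually_exists_mul_mem_Ico ht (lt_min huw hut) (min_le_right w t)]
      with N hN
    obtain ⟨i, hi, h1, h2, h3⟩ := hN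
    exact ⟨i, hi, hw _ h1 (h2.trans_le (min_le_left _ _)), fun l hl => hK _ (h3 l hl)⟩
  · simp only [hreach, iff_false]
    by_cases hvisit : ∃ u < t, x u = some s
    swap
    · refine Eventually.of_forall fun N => ?_
      rintro ⟨i, hi, hxi, -⟩
      refine hvisit ⟨_, ?_, hxi⟩
      rw [mul_div_assoc', div_lt_iff₀ (by positivity), mul_comm]
      gcongr
      exact_mod_cast Nat.lt_succ_iff.2 hi
    obtain ⟨u, hut, hu⟩ := hvisit
    -- Right-continuity makes the infimum `T` of the visits a visit. Since `s` is not reached within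
    -- `K`, the path is outside `K` at some `v < T`, and stays outside for a while.
    set S : Set ℝ≥0 := {u | x u = some s} with hS
    have hSne : S.Nonempty := ⟨u, hu⟩
    set T := sInf S with hT
    have hlow : ∀ v, x v = some s → T ≤ v := fun v hv => csInf_le (OrderBot.bddBelow S) hv
    have hxT : x T = some s := by
      rcases hxT : x T with _ | n
      · have := habs T u (hlow u hu) hxT
        rw [hu] at this
        cases this
      · obtain ⟨w, hTw, hw⟩ := hstay T n hxT
        obtain ⟨v, hv, hvw⟩ := exists_lt_of_csInf_lt hSne hTw
        rw [← hw v (hlow v hv) hvw]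
        exact hv
    have hTt : T < t := (hlow u hu).trans_lt hut
    have hleave : ∃ v < T, ∀ n ∈ K, x v ≠ some n := by
      by_contra! h
      exact hreach ⟨T, hTt, hxT, h⟩
    obtain ⟨v, hvT, hv⟩ := hleave
    have hout : ∃ w > v, ∀ v', v ≤ v' → v' < w → ∀ n ∈ K, x v' ≠ some n := by
      rcases hxv : x v with _ | m
      · refine ⟨v + 1, lt_add_one v, fun v' hv' _ n _ => ?_⟩
        rw [habs v v' hv' hxv]
        simp
      · obtain ⟨w, hvw, hw⟩ := hstay v m hxv
        refine ⟨w, hvw, fun v' h1 h2 n hn => ?_⟩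
        rw [hw v' h1 h2, ← hxv]
        exact hv n hn
    obtain ⟨w, hvw, hw⟩ := hout
    filter_upwards [eventually_exists_mul_mem_Ico ht (lt_min hvw (hvT.trans hTt))
      (min_le_right w t)] with N hN
    obtain ⟨j, -, h1, h2, -⟩ := hN
    have h2' := h2.trans_le (min_le_left _ _)
    -- The grid time `j` is spent outside `K`: a visit at a later index violates the window
    -- condition, and one at an earlier or equal index falls in `[T, w)`, where the path cannot be
    -- at `s ∈ K`.
    rintro ⟨i, hi, hxi, hl⟩
    rcases lt_or_ge j i with hji | hij
    · obtain ⟨n, hn, hxn⟩ := hl j hji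
      exact hw _ h1 h2' n hn hxn
    · refine hw _ (hvT.le.trans (hlow _ hxi)) (lt_of_le_of_lt ?_ h2') s hs hxi
      gcongr

/-- Before explosion a path with one-sided limits stays in a finite set. -/
theorem exists_forall_le_mem_Icc
    (hright : ∀ t (n : ℤ), x t = some n → ∀ᶠ u in 𝓝[>] t, x u = some n)
    (hleft : ∀ t (n : ℤ), x t = some n → ∃ m : ℤ, ∀ᶠ u in 𝓝[<] t, x u = some m)
    (habs : ∀ t u, t ≤ u → x t = none → x u = none) {u : ℝ≥0} (hu : x u = some s) :
    ∃ N : ℕ, ∀ v ≤ u, ∃ n ∈ Finset.Icc (-(N : ℤ)) N, x v = some n := by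
  -- Compactness of `[0, u]`: one-sided limits leave at most two values near each point, and the
  -- cemetery is excluded because `x u = some s`.
  have key : ∃ N : ℕ, ∀ v ∈ Set.Icc 0 u, ∃ n ∈ Finset.Icc (-(N : ℤ)) N, x v = some n := by
    refine isCompact_Icc.induction_on
      (p := fun S => ∃ N : ℕ, ∀ v ∈ S, ∃ n ∈ Finset.Icc (-(N : ℤ)) N, x v = some n)
      ⟨0, by simp⟩ ?_ ?_ ?_
    · rintro S S' hSS' ⟨N, hN⟩
      exact ⟨N, fun v hv => hN v (hSS' hv)⟩
    · rintro S S' ⟨N, hN⟩ ⟨N', hN'⟩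
      refine ⟨max N N', ?_⟩
      rintro v (hv | hv)
      · obtain ⟨n, hn, hx⟩ := hN v hv
        refine ⟨n, ?_, hx⟩
        rw [Finset.mem_Icc] at hn ⊢
        omega
      · obtain ⟨n, hn, hx⟩ := hN' v hv
        refine ⟨n, ?_, hx⟩
        rw [Finset.mem_Icc] at hn ⊢
        omega
    · intro v hv
      obtain ⟨n, hn⟩ : ∃ n, x v = some n := by
        rcases hxv : x v with _ | n
        · have := habs v u hv.2 hxv
          rw [hu] at this
          cases this
        · exact ⟨n, rfl⟩
      obtain ⟨m, hm⟩ := hleft v n hn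
      have hnear : ∀ᶠ w in 𝓝 v, x w = some n ∨ x w = some m := by
        filter_upwards [eventually_nhdsWithin_iff.1 hm, eventually_nhdsWithin_iff.1 (hright v n hn)]
          with w h1 h2
        rcases lt_trichotomy w v with h | rfl | h
        · exact Or.inr (h1 h)
        · exact Or.inl hn
        · exact Or.inl (h2 h)
      refine ⟨_, mem_nhdsWithin_of_mem_nhds hnear, n.natAbs + m.natAbs, ?_⟩
      rintro w (hw | hw)
      · refine ⟨n, ?_, hw⟩
        rw [Finset.mem_Icc]
        omega
      · refine ⟨m, ?_, hw⟩
        rw [Finset.mem_Icc]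
        omega
  obtain ⟨N, hN⟩ := key
  exact ⟨N, fun v hv => hN v ⟨zero_le, hv⟩⟩

end Paths

/-! ### Window probabilities and exhaustion of `ℤ` -/

namespace IsBilateralBirthDeath

open scoped Matrix.Norms.Operator

variable {Ω : Type*} [MeasurableSpace Ω] {P : ℤ → Measure Ω} {X : ℝ≥0 → Ω → Option ℤ}
  {lam mu : ℤ → ℝ} {k s : ℤ} {K : Finset ℤ}

theorem ae_eventually_skeleton_iff (hX : IsBilateralBirthDeath lam mu P X)
    (k : ℤ) (hs : s ∈ K) {t : ℝ≥0} (ht : 0 < t) :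
    ∀ᵐ ω ∂P k, ∀ᶠ N : ℕ in atTop,
      ω ∈ {ω | absorbedSkeleton X s K (t / (N + 1)) N ω = some s} ↔
        ω ∈ {ω | ReachesWithin (X · ω) s K t} := by
  filter_upwards [hX.right_continuous k, hX.absorbing k] with ω h1 h2
  filter_upwards [eventually_grid_iff_reachesWithin (x := (X · ω)) h1 h2 hs ht] with N hN
  exact (absorbedSkeleton_eq_target_iff hs).trans hN

/-- The event involves uncountably many times; it is handled as an almost sure limit of skeleton
events. -/
theorem nullMeasurableSet_reachesWithin (hX : IsBilateralBirthDeath lam mu P X)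
    (k : ℤ) (hs : s ∈ K) {t : ℝ≥0} (ht : 0 < t) :
    NullMeasurableSet {ω | ReachesWithin (X · ω) s K t} (P k) :=
  nullMeasurableSet_of_tendsto_indicator atTop
    (fun N => (hX.measurableSet_absorbedSkeleton hs N s).nullMeasurableSet)
    (hX.ae_eventually_skeleton_iff k hs ht)

/-- Both sides are limits of the same skeleton probabilities, by convergence of indicators and of
matrix powers respectively. -/
theorem real_reachesWithin (hX : IsBilateralBirthDeath lam mu P X)
    (hk : k ∈ K) (hs : s ∈ K) {t : ℝ≥0} (ht : 0 < t) :
    (P k).real {ω | ReachesWithin (X · ω) s K t} = absorptionProbability lam mu s K k t := by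
  have := hX.isProbabilityMeasure k
  have : Nonempty K := ⟨⟨k, hk⟩⟩
  have hnull := hX.nullMeasurableSet_reachesWithin k hs ht
  have hae := hnull.toMeasurable_ae_eq
  have hlim : Tendsto (fun N : ℕ => (P k).real
      {ω | absorbedSkeleton X s K (t / (N + 1)) N ω = some s}) atTop
      (𝓝 ((P k).real {ω | ReachesWithin (X · ω) s K t})) := by
    refine (ENNReal.tendsto_toReal (measure_ne_top _ _)).comp ?_
    rw [← measure_toMeasurable]
    refine tendsto_measure_of_ae_tendsto_indicator_of_isFiniteMeasure atTop
      (measurableSet_toMeasurable _ _) (fun N => hX.measurableSet_absorbedSkeleton hs N s) ?_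
    filter_upwards [hX.ae_eventually_skeleton_iff k hs ht, hae.mem_iff] with ω h1 h2
    filter_upwards [h1] with N hN
    rw [hN, h2]
  have hδ : Tendsto (fun N : ℕ => t / ((N : ℝ≥0) + 1)) atTop (𝓝[>] 0) := by
    refine tendsto_nhdsWithin_iff.2 ⟨tendsto_div_natCast_add_one t, ?_⟩
    exact Eventually.of_forall fun N => by rw [mem_Ioi]; positivity
  have hpow : Tendsto (fun N : ℕ => skeletonMatrix P X s K (t / (N + 1)) ^ N) atTop
      (𝓝 (NormedSpace.exp ((t : ℝ) • killedGenerator lam mu s K))) := by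
    refine tendsto_pow_exp_of_tendsto_slope (NNReal.coe_pos.2 ht) ?_
    refine (hX.tendsto_skeletonMatrix.comp hδ).congr fun N => ?_
    simp
  have hentry := tendsto_pi_nhds.1 (tendsto_pi_nhds.1 hpow ⟨k, hk⟩) ⟨s, hs⟩
  rw [absorptionProbability_of_mem hk hs]
  refine tendsto_nhds_unique hlim (hentry.congr fun N => ?_)
  exact (hX.real_absorbedSkeleton hs ⟨k, hk⟩ N ⟨s, hs⟩).symm

/-- The first-passage distribution function is the limit of the absorption probabilities of the
chains killed on leaving `{-n, …, n}`. -/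
theorem tendsto_absorptionProbability (hX : IsBilateralBirthDeath lam mu P X)
    (hks : k ≠ s) {t : ℝ} (ht : 0 < t) :
    Tendsto (fun n : ℕ => absorptionProbability lam mu s (Finset.Icc (-(n : ℤ)) n) k t) atTop
      (𝓝 (firstPassageCDF P X k s t)) := by
  have := hX.isProbabilityMeasure k
  lift t to ℝ≥0 using ht.le
  have ht' : 0 < t := NNReal.coe_pos.1 ht
  have hmono : Monotone fun n : ℕ =>
      {ω | ReachesWithin (X · ω) s (Finset.Icc (-(n : ℤ)) n) t} := by
    rintro n m hnm ω ⟨u, hut, hu, h⟩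
    refine ⟨u, hut, hu, fun v hv => ?_⟩
    obtain ⟨j, hj, hxj⟩ := h v hv
    refine ⟨j, ?_, hxj⟩
    rw [Finset.mem_Icc] at hj ⊢
    omega
  have hcdf : firstPassageCDF P X k s t =
      (P k).real (⋃ n : ℕ, {ω | ReachesWithin (X · ω) s (Finset.Icc (-(n : ℤ)) n) t}) := by
    refine measureReal_congr ?_
    filter_upwards [hX.initial k, hX.right_continuous k, hX.left_limit k, hX.absorbing k]
      with ω h0 h1 h2 h3
    refine propext ?_
    change firstPassageTime X s ω < ENNReal.ofReal t ↔
      ω ∈ ⋃ n : ℕ, {ω | ReachesWithin (X · ω) s (Finset.Icc (-(n : ℤ)) n) t}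
    simp only [firstPassageTime, iInf_lt_iff, ENNReal.ofReal_coe_nnreal, ENNReal.coe_lt_coe,
      mem_iUnion, mem_ofPred_eq]
    constructor
    · rintro ⟨u, ⟨-, hu⟩, hut⟩
      obtain ⟨N, hN⟩ := exists_forall_le_mem_Icc (x := (X · ω)) h1 h2 h3 hu
      exact ⟨N, u, hut, hu, fun v hv => hN v hv.le⟩
    · rintro ⟨N, u, hut, hu, -⟩
      -- Only strictly positive times count in the passage time; time `0` is ruled out by the start
      -- `k ≠ s`.
      refine ⟨u, ⟨pos_iff_ne_zero.2 ?_, hu⟩, hut⟩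
      rintro rfl
      exact hks (Option.some_injective _ (h0.symm.trans hu))
  rw [hcdf]
  refine ((ENNReal.tendsto_toReal (measure_ne_top _ _)).comp
    (tendsto_measure_iUnion_atTop hmono)).congr' ?_
  filter_upwards [eventually_ge_atTop (max k.natAbs s.natAbs)] with n hn
  exact hX.real_reachesWithin (by rw [Finset.mem_Icc]; omega) (by rw [Finset.mem_Icc]; omega) ht'

/-- Read off from the probabilistic meaning of the matrix entry; it supplies the domination when the
window grows. -/
theorem absorptionProbability_mem_Icc (hX : IsBilateralBirthDeath lam mu P X)
    {t : ℝ} (ht : 0 < t) :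
    absorptionProbability lam mu s K k t ∈ Set.Icc 0 1 := by
  have := hX.isProbabilityMeasure k
  by_cases h : k ∈ K ∧ s ∈ K
  · lift t to ℝ≥0 using ht.le
    rw [← hX.real_reachesWithin h.1 h.2 (NNReal.coe_pos.1 ht)]
    exact ⟨measureReal_nonneg, measureReal_le_one⟩
  · rw [absorptionProbability, dif_neg h]
    simp

end IsBilateralBirthDeath

/-! ### Density, total mass and positivity of the first-passage law -/

section FirstPassage

variable {Ω : Type*} [MeasurableSpace Ω] {P : ℤ → Measure Ω} {X : ℝ≥0 → Ω → Option ℤ}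
  {lam mu : ℤ → ℝ} {k s : ℤ}

theorem firstPassageCDF_of_nonpos {t : ℝ} (ht : t ≤ 0) : firstPassageCDF P X k s t = 0 := by
  simp [firstPassageCDF, ENNReal.ofReal_of_nonpos ht]

/-- The probability of having visited `s` by time `t`, equal to `1` for a start at `s`. -/
noncomputable def hittingProbability (P : ℤ → Measure Ω) (X : ℝ≥0 → Ω → Option ℤ) (s k : ℤ)
    (t : ℝ) : ℝ :=
  if k = s then 1 else firstPassageCDF P X k s t

theorem hittingProbability_self : hittingProbability P X s s = fun _ => 1 :=
  funext fun _ => if_pos rfl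

theorem hittingProbability_of_ne (hks : k ≠ s) :
    hittingProbability P X s k = firstPassageCDF P X k s :=
  funext fun _ => if_neg hks

theorem hittingProbability_nonneg (s k : ℤ) (t : ℝ) : 0 ≤ hittingProbability P X s k t := by
  rw [hittingProbability]
  split_ifs
  · exact zero_le_one
  · exact measureReal_nonneg

/-- The integrand of the integrated backward equation for the hitting probabilities. -/
noncomputable def backwardIntegrand (lam mu : ℤ → ℝ) (P : ℤ → Measure Ω) (X : ℝ≥0 → Ω → Option ℤ)
    (s k : ℤ) (v : ℝ) : ℝ :=
  Real.exp ((lam k + mu k) * v) *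
    (lam k * hittingProbability P X s (k + 1) v + mu k * hittingProbability P X s (k - 1) v)

namespace IsBilateralBirthDeath

theorem monotone_firstPassageCDF (hX : IsBilateralBirthDeath lam mu P X)
    (k s : ℤ) : Monotone (firstPassageCDF P X k s) := by
  have := hX.isProbabilityMeasure k
  intro t u htu
  exact measureReal_mono fun ω hω => lt_of_lt_of_le hω (ENNReal.ofReal_le_ofReal htu)

theorem monotone_hittingProbability (hX : IsBilateralBirthDeath lam mu P X)
    (s k : ℤ) : Monotone (hittingProbability P X s k) := by
  by_cases h : k = s
  · rw [h, hittingProbability_self]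
    exact monotone_const
  · rw [hittingProbability_of_ne h]
    exact hX.monotone_firstPassageCDF k s

theorem measurable_backwardIntegrand (hX : IsBilateralBirthDeath lam mu P X)
    (s k : ℤ) : Measurable (backwardIntegrand lam mu P X s k) := by
  have h1 := (hX.monotone_hittingProbability s (k + 1)).measurable
  have h2 := (hX.monotone_hittingProbability s (k - 1)).measurable
  unfold backwardIntegrand
  fun_prop

theorem intervalIntegrable_backwardIntegrand (hX : IsBilateralBirthDeath lam mu P X)
    (s k : ℤ) (a b : ℝ) :
    IntervalIntegrable (backwardIntegrand lam mu P X s k) volume a b := by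
  refine IntervalIntegrable.continuousOn_mul ?_ (by fun_prop)
  exact ((hX.monotone_hittingProbability s (k + 1)).intervalIntegrable.const_mul _).add
    ((hX.monotone_hittingProbability s (k - 1)).intervalIntegrable.const_mul _)

theorem tendsto_absorptionProbability_hittingProbability (hX : IsBilateralBirthDeath lam mu P X)
    (s k : ℤ) {t : ℝ} (ht : 0 < t) :
    Tendsto (fun n : ℕ => absorptionProbability lam mu s (Finset.Icc (-(n : ℤ)) n) k t) atTop
      (𝓝 (hittingProbability P X s k t)) := by
  by_cases h : k = s
  · subst h
    rw [hittingProbability, if_pos rfl]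
    refine tendsto_const_nhds.congr' ?_
    filter_upwards [eventually_ge_atTop k.natAbs] with n hn
    exact (absorptionProbability_self (by rw [Finset.mem_Icc]; omega) t).symm
  · rw [hittingProbability, if_neg h]
    exact hX.tendsto_absorptionProbability h ht

/-- The integrated backward equation. -/
theorem exp_mul_firstPassageCDF (hX : IsBilateralBirthDeath lam mu P X)
    (hks : k ≠ s) {t : ℝ} (ht : 0 ≤ t) :
    Real.exp ((lam k + mu k) * t) * firstPassageCDF P X k s t =
      ∫ v in (0 : ℝ)..t, backwardIntegrand lam mu P X s k v := by
  rcases ht.eq_or_lt with rfl | ht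
  · simp [firstPassageCDF_of_nonpos]
  have hlim := (hX.tendsto_absorptionProbability hks ht).const_mul
    (Real.exp ((lam k + mu k) * t))
  refine tendsto_nhds_unique hlim ?_
  have hint : Tendsto (fun n : ℕ => ∫ v in (0 : ℝ)..t, Real.exp ((lam k + mu k) * v) *
      (lam k * absorptionProbability lam mu s (Finset.Icc (-(n : ℤ)) n) (k + 1) v +
        mu k * absorptionProbability lam mu s (Finset.Icc (-(n : ℤ)) n) (k - 1) v)) atTop
      (𝓝 (∫ v in (0 : ℝ)..t, backwardIntegrand lam mu P X s k v)) := by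
    refine intervalIntegral.tendsto_integral_filter_of_dominated_convergence
      (fun v => Real.exp ((lam k + mu k) * v) * (lam k + mu k)) ?_ ?_ ?_ ?_
    · refine Eventually.of_forall fun n => Continuous.aestronglyMeasurable ?_
      have h1 : Continuous (absorptionProbability lam mu s (Finset.Icc (-(n : ℤ)) n) (k + 1)) :=
        continuous_absorptionProbability
      have h2 : Continuous (absorptionProbability lam mu s (Finset.Icc (-(n : ℤ)) n) (k - 1)) :=
        continuous_absorptionProbability
      fun_prop
    · refine Eventually.of_forall fun n => Eventually.of_forall fun v hv => ?_
      rw [uIoc_of_le ht.le] at hv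
      obtain ⟨h1, h1'⟩ := hX.absorptionProbability_mem_Icc (s := s) (k := k + 1)
        (K := Finset.Icc (-(n : ℤ)) n) hv.1
      obtain ⟨h2, h2'⟩ := hX.absorptionProbability_mem_Icc (s := s) (k := k - 1)
        (K := Finset.Icc (-(n : ℤ)) n) hv.1
      have hl := (hX.birth_pos k).le
      have hm := (hX.death_pos k).le
      rw [Real.norm_of_nonneg (by positivity)]
      gcongr
      · exact mul_le_of_le_one_right hl h1'
      · exact mul_le_of_le_one_right hm h2'
    · exact Continuous.intervalIntegrable (by fun_prop) _ _
    · refine Eventually.of_forall fun v hv => ?_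
      rw [uIoc_of_le ht.le] at hv
      exact (((hX.tendsto_absorptionProbability_hittingProbability s (k + 1) hv.1).const_mul
        (lam k)).add ((hX.tendsto_absorptionProbability_hittingProbability s (k - 1)
          hv.1).const_mul (mu k))).const_mul _
  refine hint.congr' ?_
  filter_upwards [eventually_ge_atTop (max k.natAbs s.natAbs)] with n hn
  exact (exp_mul_absorptionProbability hks (by rw [Finset.mem_Icc]; omega)
    (by rw [Finset.mem_Icc]; omega) t).symm

theorem firstPassageCDF_eq (hX : IsBilateralBirthDeath lam mu P X)
    (hks : k ≠ s) {t : ℝ} (ht : 0 ≤ t) :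
    firstPassageCDF P X k s t = Real.exp (-((lam k + mu k) * t)) *
      ∫ v in (0 : ℝ)..t, backwardIntegrand lam mu P X s k v := by
  rw [← hX.exp_mul_firstPassageCDF hks ht, ← mul_assoc, ← Real.exp_add]
  simp

/-- First half of a bootstrap: the integral of a merely monotone-built integrand is continuous; the
integrand is then itself continuous for `t > 0`, which yields differentiability. -/
theorem continuousOn_firstPassageCDF (hX : IsBilateralBirthDeath lam mu P X)
    (hks : k ≠ s) :
    ContinuousOn (firstPassageCDF P X k s) (Ici 0) := by
  have h : Continuous fun t : ℝ => ∫ v in (0 : ℝ)..t, backwardIntegrand lam mu P X s k v :=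
    intervalIntegral.continuous_primitive (hX.intervalIntegrable_backwardIntegrand s k) 0
  have h' : Continuous fun t : ℝ => Real.exp (-((lam k + mu k) * t)) *
      ∫ v in (0 : ℝ)..t, backwardIntegrand lam mu P X s k v := by fun_prop
  exact h'.continuousOn.congr fun t ht => hX.firstPassageCDF_eq hks ht

theorem continuousAt_hittingProbability (hX : IsBilateralBirthDeath lam mu P X)
    (s k : ℤ) {t : ℝ} (ht : 0 < t) :
    ContinuousAt (hittingProbability P X s k) t := by
  by_cases h : k = s
  · rw [h, hittingProbability_self]
    exact continuousAt_const
  · rw [hittingProbability_of_ne h]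
    exact (hX.continuousOn_firstPassageCDF h).continuousAt (Ici_mem_nhds ht)

theorem differentiableAt_firstPassageCDF (hX : IsBilateralBirthDeath lam mu P X)
    (hks : k ≠ s) {t : ℝ} (ht : 0 < t) :
    DifferentiableAt ℝ (firstPassageCDF P X k s) t := by
  have hc : ContinuousAt (backwardIntegrand lam mu P X s k) t := by
    have h1 := hX.continuousAt_hittingProbability s (k + 1) ht
    have h2 := hX.continuousAt_hittingProbability s (k - 1) ht
    unfold backwardIntegrand
    fun_prop
  have hd : DifferentiableAt ℝ
      (fun t : ℝ => ∫ v in (0 : ℝ)..t, backwardIntegrand lam mu P X s k v) t :=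
    (intervalIntegral.integral_hasDerivAt_right (hX.intervalIntegrable_backwardIntegrand s k 0 t)
      ((hX.measurable_backwardIntegrand s k).stronglyMeasurable.stronglyMeasurableAtFilter)
      hc).differentiableAt
  have hd' : DifferentiableAt ℝ (fun t : ℝ => Real.exp (-((lam k + mu k) * t)) *
      ∫ v in (0 : ℝ)..t, backwardIntegrand lam mu P X s k v) t := by fun_prop
  refine hd'.congr_of_eventuallyEq ?_
  filter_upwards [Ici_mem_nhds ht] with u hu
  exact hX.firstPassageCDF_eq hks hu

theorem hasDerivAt_firstPassageCDF (hX : IsBilateralBirthDeath lam mu P X)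
    (hks : k ≠ s) {t : ℝ} (ht : 0 < t) :
    HasDerivAt (firstPassageCDF P X k s) (firstPassageDensity P X k s t) t :=
  (hX.differentiableAt_firstPassageCDF hks ht).hasDerivAt

theorem firstPassageDensity_nonneg (hX : IsBilateralBirthDeath lam mu P X)
    (k s : ℤ) (t : ℝ) : 0 ≤ firstPassageDensity P X k s t :=
  (hX.monotone_firstPassageCDF k s).deriv_nonneg

theorem tendsto_firstPassageCDF_atTop (hX : IsBilateralBirthDeath lam mu P X)
    (k s : ℤ) :
    Tendsto (firstPassageCDF P X k s) atTop (𝓝 (⨆ t, firstPassageCDF P X k s t)) := by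
  have := hX.isProbabilityMeasure k
  refine tendsto_atTop_ciSup (hX.monotone_firstPassageCDF k s) ⟨1, ?_⟩
  rintro _ ⟨t, rfl⟩
  exact measureReal_le_one

/-- The derivative of a bounded monotone function is nonnegative, so integrability comes for free;
continuity at `0` excludes an atom there. -/
theorem hasFirstPassageDensity (hX : IsBilateralBirthDeath lam mu P X)
    (hks : k ≠ s) : HasFirstPassageDensity P X k s := by
  have hint : IntegrableOn (firstPassageDensity P X k s) (Ioi 0) :=
    integrableOn_Ioi_deriv_of_nonneg (hX.continuousOn_firstPassageCDF hks 0 self_mem_Ici)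
      (fun t ht => hX.hasDerivAt_firstPassageCDF hks ht)
      (fun t _ => hX.firstPassageDensity_nonneg k s t) (hX.tendsto_firstPassageCDF_atTop k s)
  refine ⟨fun t ht => hX.differentiableAt_firstPassageCDF hks ht, hint, fun t ht => ?_⟩
  rw [intervalIntegral.integral_eq_sub_of_hasDerivAt_of_le ht
    ((hX.continuousOn_firstPassageCDF hks).mono Icc_subset_Ici_self)
    (fun u hu => hX.hasDerivAt_firstPassageCDF hks hu.1)
    ((intervalIntegrable_iff_integrableOn_Ioc_of_le ht).2 (hint.mono_set Ioc_subset_Ioi_self)),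
    firstPassageCDF_of_nonpos le_rfl, sub_zero]

theorem crossingProbability_eq (hX : IsBilateralBirthDeath lam mu P X)
    (hks : k ≠ s) :
    crossingProbability P X k s = ⨆ t, firstPassageCDF P X k s t := by
  rw [crossingProbability, integral_Ioi_of_hasDerivAt_of_nonneg
    (hX.continuousOn_firstPassageCDF hks 0 self_mem_Ici)
    (fun t ht => hX.hasDerivAt_firstPassageCDF hks ht)
    (fun t _ => hX.firstPassageDensity_nonneg k s t) (hX.tendsto_firstPassageCDF_atTop k s),
    firstPassageCDF_of_nonpos le_rfl, sub_zero]

theorem firstPassageCDF_pos_of_neighbour (hX : IsBilateralBirthDeath lam mu P X)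
    (hks : k ≠ s)
    (h : (∀ t, 0 < t → 0 < hittingProbability P X s (k + 1) t) ∨
      ∀ t, 0 < t → 0 < hittingProbability P X s (k - 1) t) {t : ℝ} (ht : 0 < t) :
    0 < firstPassageCDF P X k s t := by
  rw [hX.firstPassageCDF_eq hks ht.le]
  refine mul_pos (Real.exp_pos _) (intervalIntegral.intervalIntegral_pos_of_pos_on
    (hX.intervalIntegrable_backwardIntegrand s k 0 t) (fun v hv => ?_) ht)
  have h1 := hittingProbability_nonneg (P := P) (X := X) s (k + 1) v
  have h2 := hittingProbability_nonneg (P := P) (X := X) s (k - 1) v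
  have hl := hX.birth_pos k
  have hm := hX.death_pos k
  refine mul_pos (Real.exp_pos _) ?_
  rcases h with h | h
  · have := h v hv.1
    positivity
  · have := h v hv.1
    positivity

/-- Induction outward from `s` in both directions: the neighbour nearer to `s` makes the backward
integrand positive. -/
theorem hittingProbability_pos (hX : IsBilateralBirthDeath lam mu P X)
    (s k : ℤ) : ∀ t, 0 < t → 0 < hittingProbability P X s k t := by
  rcases le_total s k with hk | hk
  · induction k, hk using Int.leInduction with
    | base => intro t _; simp [hittingProbability]
    | succ k hk ih =>
      intro t ht
      have hne : k + 1 ≠ s := by omega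
      rw [hittingProbability, if_neg hne]
      exact hX.firstPassageCDF_pos_of_neighbour hne (Or.inr (by simpa using ih)) ht
  · induction k, hk using Int.leInductionDown with
    | base => intro t _; simp [hittingProbability]
    | pred k hk ih =>
      intro t ht
      have hne : k - 1 ≠ s := by omega
      rw [hittingProbability, if_neg hne]
      exact hX.firstPassageCDF_pos_of_neighbour hne (Or.inl (by simpa using ih)) ht

theorem crossingProbability_pos (hX : IsBilateralBirthDeath lam mu P X)
    (hks : k ≠ s) : 0 < crossingProbability P X k s := by
  have h := hX.hittingProbability_pos s k 1 one_pos
  rw [hittingProbability, if_neg hks] at h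
  rw [hX.crossingProbability_eq hks]
  exact h.trans_le ((hX.monotone_firstPassageCDF k s).ge_of_tendsto
    (hX.tendsto_firstPassageCDF_atTop k s) 1)

/-- First-passage distribution functions under the Doob transform by a harmonic function `nu`. -/
theorem firstPassageCDF_doobTransform (hX : IsBilateralBirthDeath lam mu P X)
    {nu : ℤ → ℝ} {Ω' : Type*} [MeasurableSpace Ω']
    {P' : ℤ → Measure Ω'} {X' : ℝ≥0 → Ω' → Option ℤ} (hnu_pos : ∀ n, 0 < nu n)
    (hnu : ∀ n, nu (n + 1) * lam n - nu n * (lam n + mu n) + nu (n - 1) * mu n = 0)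
    (hX' : IsBilateralBirthDeath (fun n => lam n * (nu (n + 1) / nu n))
      (fun n => mu n * (nu (n - 1) / nu n)) P' X') (hks : k ≠ s) (t : ℝ) :
    firstPassageCDF P' X' k s t = nu s / nu k * firstPassageCDF P X k s t := by
  rcases le_or_gt t 0 with ht | ht
  · simp [firstPassageCDF_of_nonpos ht]
  · refine tendsto_nhds_unique (hX'.tendsto_absorptionProbability hks ht)
      (((hX.tendsto_absorptionProbability hks ht).const_mul (nu s / nu k)).congr fun n => ?_)
    exact (absorptionProbability_doobTransform hnu_pos hnu t).symm

end IsBilateralBirthDeath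

end FirstPassage

theorem theorem2 (lam mu nu : ℤ → ℝ)
    {Ω : Type*} [MeasurableSpace Ω] (P : ℤ → Measure Ω) (X : ℝ≥0 → Ω → Option ℤ)
    {Ω' : Type*} [MeasurableSpace Ω'] (P' : ℤ → Measure Ω') (X' : ℝ≥0 → Ω' → Option ℤ)
    (hX : IsBilateralBirthDeath lam mu P X)
    (hnu_pos : ∀ n, 0 < nu n)
    (hnu_mono : StrictMono nu ∨ StrictAnti nu)
    (hnu : ∀ n, nu (n + 1) * lam n - nu n * (lam n + mu n) + nu (n - 1) * mu n = 0)
    (hX' : IsBilateralBirthDeath (fun n => lam n * (nu (n + 1) / nu n))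
      (fun n => mu n * (nu (n - 1) / nu n)) P' X') :
    ∀ k s : ℤ, k ≠ s →
      HasFirstPassageDensity P X k s ∧
      HasFirstPassageDensity P' X' k s ∧
      (∀ t : ℝ, 0 < t →
        firstPassageDensity P' X' k s t = nu s / nu k * firstPassageDensity P X k s t) ∧
      crossingProbability P' X' k s = nu s / nu k * crossingProbability P X k s ∧
      crossingProbability P' X' k s ≠ crossingProbability P X k s := by
  intro k s hks
  have hcdf : firstPassageCDF P' X' k s = fun t => nu s / nu k * firstPassageCDF P X k s t :=
    funext fun t => hX.firstPassageCDF_doobTransform hnu_pos hnu hX' hks t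
  have hdens : ∀ t : ℝ, 0 < t →
      firstPassageDensity P' X' k s t = nu s / nu k * firstPassageDensity P X k s t := by
    intro t ht
    rw [firstPassageDensity, hcdf]
    exact ((hX.hasDerivAt_firstPassageCDF hks ht).const_mul _).deriv
  have hcross : crossingProbability P' X' k s = nu s / nu k * crossingProbability P X k s := by
    rw [crossingProbability, crossingProbability, ← integral_const_mul]
    exact setIntegral_congr_fun measurableSet_Ioi fun t ht => hdens t ht
  refine ⟨hX.hasFirstPassageDensity hks, hX'.hasFirstPassageDensity hks, hdens, hcross, ?_⟩
  rw [hcross]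
  intro h
  -- Positivity of the crossing probability is essential here: two zero probabilities would agree
  -- whatever the ratio.
  have hratio : nu s / nu k = 1 :=
    mul_right_cancel₀ (hX.crossingProbability_pos hks).ne' (h.trans (one_mul _).symm)
  have hinj : Function.Injective nu := hnu_mono.elim StrictMono.injective StrictAnti.injective
  exact hks (hinj ((div_eq_one_iff_eq (hnu_pos k).ne').1 hratio)).symm
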